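/- Let $L^2=L^2(\mathbb T,m)$ and $L^\infty=L^\infty(\mathbb T,m)$, where $m$ is normalized Lebesgue measure on the unit circle $\mathbb T$, let $H^2\subset L^2$ be the Hardy space and $H^2_-=L^2\ominus H^2=\overline{zH^2}$. For an inner function $\theta$ put $K_\theta=H^2\ominus\theta H^2$ and let $K_\theta^\perp=\theta H^2\oplus H^2_-$ be its orthogonal complement in $L^2$. Let $P_{\theta H^2}$, $P^-$ and $P_\theta^\perp$ denote the orthogonal projections of $L^2$ onto $\theta H^2$, $H^2_-$ and $K_\theta^\perp$, and let $M_\varphi f=\varphi f$. For subspaces $\mathcal K_1,\mathcal K_2\subset L^2$, an operator $A\in\mathcal B(\mathcal K_1,\mathcal K_2)$ is called shift invariant if $\langle A(zf),zg\rangle=\langle Af,g\rangle$ for all $f\in\mathcal K_1$, $g\in\mathcal K_2$ with $zf\in\mathcal K_1$ and $zg\in\mathcal K_2$. For inner functions $\theta,\alpha$ let $\mathcal T^2(K_\theta^\perp,K_\alpha^\perp)$ be the set of all $D\in\mathcal B(K_\theta^\perp,K_\alpha^\perp)$ whose block matrix with respect to $K_\theta^\perp=\theta H^2\oplus H^2_-$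 and $K_\alpha^\perp=\alpha H^2\oplus H^2_-$ is $$\begin{bmatrix}P_{\alpha H^2}M_{\varphi_1}|_{\theta H^2}&P_{\alpha H^2}M_{\varphi_2}|_{H^2_-}\\ P^-M_{\varphi_3}|_{\theta H^2}&P^-M_{\varphi_4}|_{H^2_-}\end{bmatrix}$$ for some $\varphi_1,\varphi_2,\varphi_3,\varphi_4\in L^\infty$. Let $\mathcal T(K_\theta^\perp,K_\alpha^\perp)$ be the set of asymmetric dual truncated Toeplitz operators, that is, of all $D\in\mathcal B(K_\theta^\perp,K_\alpha^\perp)$ for which there is $\varphi\in L^2$ with $Df=P_\alpha^\perp(\varphi f)$ for all $f\in K_\theta^\perp\cap L^\infty$. **Theorem.** Let $\theta$ and $\alpha$ be nonconstant inner functions. An operator $D\in\mathcal B(K_\theta^\perp,K_\alpha^\perp)$ is shift invariant if and only if $D\in\mathcal T^2(K_\theta^\perp,K_\alpha^\perp)$. Moreover, $\mathcal T(K_\theta^\perp,K_\alpha^\perp)\subsetneq\mathcal T^2(K_\theta^\perp,K_\alpha^\perp)$. -/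

import Mathlib

open MeasureTheory AddCircle
open scoped ENNReal

noncomputable section

namespace DualToeplitz

/-! The unit circle is parametrized as `ℝ / ℤ` through `t ↦ exp (2 π i t)`; the normalized Lebesgue
measure is then the Haar probability measure, and the monomial `z ^ n` is `fourier n`. -/

/-- The normalized Lebesgue measure `m` on the unit circle. -/
abbrev circleMeasure : Measure (AddCircle (1 : ℝ)) := haarAddCircle

/-- The space `L²` of the unit circle. -/
abbrev L2 : Type := Lp ℂ 2 circleMeasure

/-- The space `L^∞` of the unit circle. -/
abbrev Linf : Type := Lp ℂ ∞ circleMeasure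

/-- The multiplication operator `M_φ f = φ f` on `L²`, for `φ ∈ L^∞`. -/
def mulOp (φ : Linf) : L2 →L[ℂ] L2 :=
  (ContinuousLinearMap.mul ℂ ℂ).holderL circleMeasure ∞ 2 2 φ

lemma coeFn_mulOp (φ : Linf) (f : L2) :
    (mulOp φ f : AddCircle (1 : ℝ) → ℂ) =ᵐ[circleMeasure] fun x => φ x * f x :=
  (ContinuousLinearMap.mul ℂ ℂ).coeFn_holder φ f

/-- The independent variable `z`, as an element of `L^∞`. -/
def zInf : Linf := fourierLp ∞ 1

/-- The Hardy space `H²`: functions in `L²` whose Fourier coefficients of negative index vanish. -/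
def hardySpace : Submodule ℂ L2 where
  carrier := {f | ∀ n : ℤ, n < 0 → fourierCoeff f n = 0}
  add_mem' := by
    intro f g hf hg n hn
    have h := congrArg (fun v => v n) (map_add (fourierBasis (T := 1)).repr f g)
    simp only [lp.coeFn_add, Pi.add_apply, fourierBasis_repr] at h
    rw [h, hf n hn, hg n hn, add_zero]
  zero_mem' := by
    intro n _
    have h := congrArg (fun v => v n) (map_zero (fourierBasis (T := 1)).repr)
    simpa only [lp.coeFn_zero, Pi.zero_apply, fourierBasis_repr] using h
  smul_mem' := by
    intro c f hf n hn
    have h := congrArg (fun v => v n) (map_smul (fourierBasis (T := 1)).repr c f)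
    simp only [lp.coeFn_smul, Pi.smul_apply, fourierBasis_repr] at h
    rw [h, hf n hn, smul_zero]

lemma isClosed_hardySpace : IsClosed (hardySpace : Set L2) := by
  have h : (hardySpace : Set L2) =
      ⋂ n : ℤ, ⋂ _ : n < 0, {f : L2 | inner ℂ (fourierBasis (T := 1) n) f = 0} := by
    ext f
    simp only [Set.mem_iInter, Set.mem_ofPred_eq, ← HilbertBasis.repr_apply_apply,
      fourierBasis_repr]
    rfl
  rw [h]
  refine isClosed_iInter fun n => isClosed_iInter fun _ => ?_
  exact isClosed_eq (by fun_prop) continuous_const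

/-- The space `H²₋ = L² ⊖ H²`, that is, the space of all `conj (z g)` with `g ∈ H²`. The orthogonal
projection onto it is `P⁻ = I - P⁺`. -/
abbrev hardyMinus : Submodule ℂ L2 := hardySpaceᗮ

/-- Inner functions, given by their boundary values: functions in
`H^∞ = {φ ∈ L^∞ | the Fourier coefficients of φ of negative index vanish}` that are unimodular
almost everywhere on the circle. -/
structure InnerFunction where
  /-- the boundary function -/
  toLinf : Linf
  norm_eq_one : ∀ᵐ x ∂circleMeasure, ‖toLinf x‖ = 1
  fourierCoeff_eq_zero : ∀ n : ℤ, n < 0 → fourierCoeff toLinf n = 0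

/-- The inner function `θ` is not (almost everywhere equal to) a constant. -/
def InnerFunction.Nonconstant (θ : InnerFunction) : Prop :=
  ¬ ∃ c : ℂ, θ.toLinf =ᵐ[circleMeasure] fun _ => c

/-- The space `θ H²`. -/
def InnerFunction.timesHardy (θ : InnerFunction) : Submodule ℂ L2 :=
  hardySpace.map (mulOp θ.toLinf).toLinearMap

lemma InnerFunction.norm_mulOp (θ : InnerFunction) (f : L2) : ‖mulOp θ.toLinf f‖ = ‖f‖ := by
  rw [Lp.norm_def, Lp.norm_def]
  congr 1
  refine eLpNorm_congr_norm_ae ?_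
  filter_upwards [coeFn_mulOp θ.toLinf f, θ.norm_eq_one] with x hx h1
  rw [hx, norm_mul, h1, one_mul]

instance (θ : InnerFunction) : CompleteSpace θ.timesHardy := by
  have hi : Isometry (mulOp θ.toLinf) :=
    AddMonoidHomClass.isometry_of_norm _ θ.norm_mulOp
  have hc : IsClosed (mulOp θ.toLinf '' (hardySpace : Set L2)) :=
    hi.isClosedEmbedding.isClosedMap _ isClosed_hardySpace
  exact IsClosed.completeSpace_coe (hs := hc)

/-- The model space `K_θ = H² ⊖ θ H²`. -/
def modelSpace (θ : InnerFunction) : Submodule ℂ L2 := hardySpace ⊓ (θ.timesHardy)ᗮ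

/-- The orthogonal complement `K_θ^⊥` of the model space in `L²`. -/
abbrev modelPerp (θ : InnerFunction) : Submodule ℂ L2 := (modelSpace θ)ᗮ

lemma timesHardy_le_modelPerp (θ : InnerFunction) : θ.timesHardy ≤ modelPerp θ :=
  (Submodule.le_orthogonal_orthogonal _).trans (Submodule.orthogonal_le inf_le_right)

lemma hardyMinus_le_modelPerp (θ : InnerFunction) : hardyMinus ≤ modelPerp θ :=
  Submodule.orthogonal_le inf_le_left

/-- A bounded operator `A : K₁ → K₂` between subspaces of `L²` is shift invariant if
`⟨A (z f), z g⟩ = ⟨A f, g⟩` for all `f ∈ K₁`, `g ∈ K₂` with `z f ∈ K₁` and `z g ∈ K₂`.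
(Mathlib's inner product is linear in its second argument.) -/
def IsShiftInvariant {K₁ K₂ : Submodule ℂ L2} (A : K₁ →L[ℂ] K₂) : Prop :=
  ∀ (f : K₁) (g : K₂) (hf : mulOp zInf f ∈ K₁) (hg : mulOp zInf g ∈ K₂),
    inner ℂ (⟨mulOp zInf g, hg⟩ : K₂) (A ⟨mulOp zInf f, hf⟩) = inner ℂ g (A f)

/-- For `φ ∈ L^∞`, the compression `P_{K₂} M_φ|_{K₁} : K₁ → K₂`. -/
def compression (K₁ K₂ : Submodule ℂ L2) [K₂.HasOrthogonalProjection] (φ : Linf) :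
    K₁ →L[ℂ] K₂ :=
  K₂.orthogonalProjectionOnto ∘L mulOp φ ∘L K₁.subtypeL

/-- `P_{α H²} M_φ|_{θ H²} : θ H² → α H²`. -/
def toeplitzHat (θ α : InnerFunction) (φ : Linf) : θ.timesHardy →L[ℂ] α.timesHardy :=
  compression θ.timesHardy α.timesHardy φ

/-- `P_{α H²} M_φ|_{H²₋} : H²₋ → α H²`. -/
def hankelCheck (α : InnerFunction) (φ : Linf) : hardyMinus →L[ℂ] α.timesHardy :=
  compression hardyMinus α.timesHardy φ

/-- `P⁻ M_φ|_{θ H²} : θ H² → H²₋`. -/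
def hankelHat (θ : InnerFunction) (φ : Linf) : θ.timesHardy →L[ℂ] hardyMinus :=
  compression θ.timesHardy hardyMinus φ

/-- `P⁻ M_φ|_{H²₋} : H²₋ → H²₋`. -/
def toeplitzCheck (φ : Linf) : hardyMinus →L[ℂ] hardyMinus :=
  compression hardyMinus hardyMinus φ

/-- The entry `P_N D|_M : M → N` of the block matrix of `D : K₁ → K₂`, for `M ⊆ K₁`. -/
def block {K₁ K₂ M : Submodule ℂ L2} (hM : M ≤ K₁) (N : Submodule ℂ L2)
    [N.HasOrthogonalProjection] (D : K₁ →L[ℂ] K₂) : M →L[ℂ] N :=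
  N.orthogonalProjectionOnto ∘L K₂.subtypeL ∘L D ∘L
    (Submodule.subtypeL M).codRestrict K₁ (fun x => hM x.2)

/-- The class `𝒯²(K_θ^⊥, K_α^⊥)`: operators whose block matrix with respect to the decompositions
`K_θ^⊥ = θ H² ⊕ H²₋` and `K_α^⊥ = α H² ⊕ H²₋` has the form
`[T̂_{φ₁}, Γ̌_{φ₂}; Γ̂_{φ₃}, Ť_{φ₄}]` with `φ₁, φ₂, φ₃, φ₄ ∈ L^∞`. -/
def toeplitzBlockClass (θ α : InnerFunction) : Set (modelPerp θ →L[ℂ] modelPerp α) :=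
  {D | ∃ φ₁ φ₂ φ₃ φ₄ : Linf,
    block (timesHardy_le_modelPerp θ) α.timesHardy D = toeplitzHat θ α φ₁ ∧
    block (hardyMinus_le_modelPerp θ) α.timesHardy D = hankelCheck α φ₂ ∧
    block (timesHardy_le_modelPerp θ) hardyMinus D = hankelHat θ φ₃ ∧
    block (hardyMinus_le_modelPerp θ) hardyMinus D = toeplitzCheck φ₄}

/-- The class `𝒯(K_θ^⊥, K_α^⊥)` of asymmetric dual truncated Toeplitz operators: bounded operators
that, for some symbol `φ ∈ L²`, agree with `f ↦ P_{K_α^⊥} (φ f)` on `K_θ^⊥ ∩ L^∞`. Here `b` is `f`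
regarded as an element of `L^∞`, and `mulOp b φ = b φ` is the product `φ f ∈ L²`. -/
def dualToeplitzClass (θ α : InnerFunction) : Set (modelPerp θ →L[ℂ] modelPerp α) :=
  {D | ∃ φ : L2, ∀ (f : modelPerp θ) (b : Linf), b =ᵐ[circleMeasure] (f : L2) →
    D f = (modelPerp α).orthogonalProjectionOnto (mulOp b φ)}

end DualToeplitz

end

/-!
The four blocks of an operator `D : K_θ^⊥ → K_α^⊥` act between spaces with the orthonormal bases
`θ z^i`, `α z^i` and `z^(-1-i)`, `i ≥ 0` (`MonomialBasis`). As the exponents run upwards or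
downwards, shift invariance of a block says that its matrix in these bases is a Toeplitz matrix (the
diagonal blocks) or a Hankel matrix (the off-diagonal ones): the entries are
`γ (difference of the exponents)`, see `IsShiftInvariant.exists_matrix`. Such a block is the
compression of a multiplication operator with bounded symbol (`exists_eq_compression`):

* If the two-sided infinite Laurent matrix `(γ (n - m))` is bounded, its first column is an element
  `φ` of `L²`, multiplication by `φ` is bounded on trigonometric polynomials, and therefore `φ` is
  essentially bounded (`IsLaurentBounded.exists_symbol`).
* For a bounded Toeplitz matrix all windows of the Laurent matrix are windows of the given one, so
  that the Laurent matrix is bounded (Brown–Halmos, `isLaurentBounded_of_toeplitz`).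
* A Hankel matrix gives only half of the sequence `γ`. The other half is found one term at a time by
  Parrott's completion theorem (`exists_corner_bound`, `IsHankel.exists_cons`), with a loss in the
  norm that is kept summable, and in the limit the Laurent matrix is bounded (Nehari,
  `IsHankel.exists_isLaurentBounded`).

Conversely, compressions of multiplication operators are shift invariant, and the blocks determine
the behaviour of `D` on pairs `f`, `z f`, because the components of `f` in `θ H²` and `H²₋` stay there
after multiplication by `z`: the only obstruction is a constant, and `K_θ^⊥` contains no constant but
`0` when `θ` is not constant (`InnerFunction.Nonconstant.exists_add`).

The blocks of a dual truncated Toeplitz operator with symbol `φ ∈ L²` have entries that depend only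
on the difference of the exponents, so they have bounded symbols by the same theorem. The inclusion is
strict because `P⁻` is in the larger class, while a symbol `φ` of it would have to be `1` in view of
the lower right block and satisfy `conj α θ φ = 0` in view of the upper left block.
-/

open MeasureTheory AddCircle
open scoped ENNReal

noncomputable section

namespace DualToeplitz

section HilbertSpace

variable {E F : Type*} [NormedAddCommGroup E] [InnerProductSpace ℂ E]
  [NormedAddCommGroup F] [InnerProductSpace ℂ F]

open ContinuousLinearMap (adjoint adjoint_inner_left adjoint_inner_right)

lemma clm_ext_hilbertBasis {ι : Type*} (b : HilbertBasis ι ℂ E) {G : Type*}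
    [NormedAddCommGroup G] [NormedSpace ℂ G] {A B : E →L[ℂ] G} (h : ∀ i, A (b i) = B (b i)) :
    A = B :=
  ContinuousLinearMap.ext_on
    (Submodule.dense_iff_topologicalClosure_eq_top.2 b.dense_span) (by rintro _ ⟨i, rfl⟩; exact h i)

lemma ext_hilbertBasis {ι : Type*} (b : HilbertBasis ι ℂ E) {x y : E}
    (h : ∀ i, inner ℂ (b i) x = inner ℂ (b i) y) : x = y := by
  apply b.repr.injective
  ext i
  rw [b.repr_apply_apply, b.repr_apply_apply, h]

variable [CompleteSpace E] [CompleteSpace F]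

/-! ### Completing a two-by-two operator matrix -/

lemma exists_eq_adjoint_apply_add {M : E →L[ℂ] F} {C : ℝ} (hM : ‖M‖ < C) (c : F) :
    ∃ w : E, adjoint M (c + M w) = ((C ^ 2 : ℝ) : ℂ) • w := by
  have hC : 0 < C := (norm_nonneg _).trans_lt hM
  set T : E →L[ℂ] E := (((C ^ 2)⁻¹ : ℝ) : ℂ) • (adjoint M ∘L M) with hT
  have hT1 : ‖T‖ < 1 := by
    have h1 : ‖adjoint M ∘L M‖ ≤ ‖M‖ * ‖M‖ :=
      (ContinuousLinearMap.opNorm_comp_le _ _).trans_eq (by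
        rw [LinearIsometryEquiv.norm_map])
    have h2 : ‖M‖ * ‖M‖ < C ^ 2 := by nlinarith [norm_nonneg M]
    rw [hT, norm_smul, Complex.norm_real, Real.norm_of_nonneg (by positivity),
      inv_mul_lt_one₀ (by positivity)]
    exact h1.trans_lt h2
  obtain ⟨u, hu⟩ := isUnit_one_sub_of_norm_lt_one hT1
  refine ⟨(↑u⁻¹ : E →L[ℂ] E) ((((C ^ 2)⁻¹ : ℝ) : ℂ) • adjoint M c), ?_⟩
  set w := (↑u⁻¹ : E →L[ℂ] E) ((((C ^ 2)⁻¹ : ℝ) : ℂ) • adjoint M c) with hw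
  have h3 : (1 - T) w = (((C ^ 2)⁻¹ : ℝ) : ℂ) • adjoint M c := by
    rw [← hu, hw, ← mul_apply_eq_comp, Units.mul_inv, one_apply_eq_self]
  have h4 : w = (((C ^ 2)⁻¹ : ℝ) : ℂ) • adjoint M (c + M w) := by
    have : w - T w = (((C ^ 2)⁻¹ : ℝ) : ℂ) • adjoint M c := h3
    rw [map_add, smul_add, ← this, hT]
    simp
  have hC' : ((C ^ 2 : ℝ) : ℂ) ≠ 0 := by exact_mod_cast (by positivity : C ^ 2 ≠ 0)
  conv_rhs => rw [h4]
  rw [smul_smul, Complex.ofReal_inv, mul_inv_cancel₀ hC', one_smul]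

/-- Parrott's completion theorem with a scalar unknown corner: if the row `(c, M)` and the column
`(⟪r, ·⟫, M)` are bounded by `C`, and `‖M‖ < C`, then the matrix `(x, ⟪r, ·⟫; c, M)` is bounded by
`C` for a suitable scalar `x`. With `w` solving `M* (c + M w) = C² w`, the choice `x = -⟪r, w⟫`
works: after the substitution `u = s w + v` the cross terms in `C² ‖u‖² - ‖s c + M u‖²` cancel. -/
theorem exists_corner_bound {M : E →L[ℂ] F} {C : ℝ} (hM : ‖M‖ < C) (c : F) (r : E)
    (hrow : ∀ (s : ℂ) (u : E), ‖s • c + M u‖ ^ 2 ≤ C ^ 2 * (‖s‖ ^ 2 + ‖u‖ ^ 2))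
    (hcol : ∀ u : E, ‖inner ℂ r u‖ ^ 2 + ‖M u‖ ^ 2 ≤ C ^ 2 * ‖u‖ ^ 2) :
    ∃ x : ℂ, ∀ (s : ℂ) (u : E),
      ‖s * x + inner ℂ r u‖ ^ 2 + ‖s • c + M u‖ ^ 2 ≤ C ^ 2 * (‖s‖ ^ 2 + ‖u‖ ^ 2) := by
  obtain ⟨w, hw⟩ := exists_eq_adjoint_apply_add hM c
  refine ⟨-inner ℂ r w, fun s u => ?_⟩
  obtain ⟨v, rfl⟩ : ∃ v, u = s • w + v := ⟨u - s • w, by abel⟩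
  have e1 : s * -inner ℂ r w + inner ℂ r (s • w + v) = inner ℂ r v := by
    rw [inner_add_right, inner_smul_right]; ring
  have e2 : s • c + M (s • w + v) = s • (c + M w) + M v := by
    rw [map_add, map_smul, smul_add]; abel
  have hcross : RCLike.re (inner ℂ (s • (c + M w)) (M v)) =
      C ^ 2 * RCLike.re (inner ℂ (s • w) v) := by
    rw [inner_smul_left, inner_smul_left, ← adjoint_inner_left, hw, inner_smul_left,
      Complex.conj_ofReal, mul_left_comm]
    exact Complex.re_ofReal_mul _ _
  rw [e1, e2, @norm_add_sq ℂ, @norm_add_sq ℂ _ _ _ _ (s • w), hcross, norm_smul, norm_smul]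
  have h1 := hrow 1 w
  rw [one_smul, norm_one] at h1
  nlinarith [hcol v, mul_le_mul_of_nonneg_left h1 (sq_nonneg ‖s‖)]

/-! ### The shift attached to a Hilbert basis -/

/-- The unilateral shift `b i ↦ b (i + 1)` along a Hilbert basis indexed by `ℕ`. -/
def shift (b : HilbertBasis ℕ ℂ E) : E →L[ℂ] E :=
  ((b.orthonormal.comp _ Nat.succ_injective).orthogonalFamily.linearIsometry.comp
    b.repr.toLinearIsometry).toContinuousLinearMap

lemma norm_shift (b : HilbertBasis ℕ ℂ E) (x : E) : ‖shift b x‖ = ‖x‖ :=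
  LinearIsometry.norm_map _ x

lemma shift_basis (b : HilbertBasis ℕ ℂ E) (i : ℕ) : shift b (b i) = b (i + 1) := by
  classical
  have h := (b.orthonormal.comp _ Nat.succ_injective).orthogonalFamily.linearIsometry_apply_single
    (i := i) (1 : ℂ)
  rw [← b.repr_self] at h
  exact h.trans (by simp)

lemma adjoint_shift_basis_zero (b : HilbertBasis ℕ ℂ E) : adjoint (shift b) (b 0) = 0 := by
  refine ext_hilbertBasis b fun i => ?_
  rw [adjoint_inner_right, shift_basis, inner_zero_right]
  exact b.orthonormal.2 (Nat.succ_ne_zero i)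

lemma adjoint_shift_basis_succ (b : HilbertBasis ℕ ℂ E) (i : ℕ) :
    adjoint (shift b) (b (i + 1)) = b i := by
  refine ext_hilbertBasis b fun j => ?_
  rw [adjoint_inner_right, shift_basis, orthonormal_iff_ite.1 b.orthonormal,
    orthonormal_iff_ite.1 b.orthonormal]
  simp

lemma shift_adjoint_shift (b : HilbertBasis ℕ ℂ E) (x : E) :
    inner ℂ (b 0) x • b 0 + shift b (adjoint (shift b) x) = x := by
  have : (innerSL ℂ (b 0)).smulRight (b 0) + shift b ∘L adjoint (shift b) =
      ContinuousLinearMap.id ℂ E :=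
    clm_ext_hilbertBasis b fun i => by
      cases i with
      | zero => simp [adjoint_shift_basis_zero, b.orthonormal.1 0]
      | succ i =>
        have : inner ℂ (b 0) (b (i + 1)) = 0 := b.orthonormal.2 (Nat.succ_ne_zero i).symm
        simp [shift_basis, adjoint_shift_basis_succ, this]
  exact congrArg (fun T => T x) this

lemma inner_basis_zero_shift (b : HilbertBasis ℕ ℂ E) (x : E) :
    inner ℂ (b 0) (shift b x) = 0 := by
  rw [← adjoint_inner_left, adjoint_shift_basis_zero, inner_zero_left]

lemma norm_sq_smul_add_shift (b : HilbertBasis ℕ ℂ E) (s : ℂ) (x : E) :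
    ‖s • b 0 + shift b x‖ ^ 2 = ‖s‖ ^ 2 + ‖x‖ ^ 2 := by
  rw [@norm_add_sq ℂ, inner_smul_left, inner_basis_zero_shift, norm_smul, norm_shift,
    b.orthonormal.1]
  simp

/-! ### Nehari's extension theorem for Hankel matrices -/

/-- `IsHankel v w c C`: some operator of norm at most `C` has, with respect to the Hilbert bases `v`
and `w`, the Hankel matrix with the entries `c (i + j)`. -/
def IsHankel (v : HilbertBasis ℕ ℂ E) (w : HilbertBasis ℕ ℂ F) (c : ℕ → ℂ) (C : ℝ) : Prop :=
  ∃ G : E →L[ℂ] F, ‖G‖ ≤ C ∧ ∀ i j, inner ℂ (w j) (G (v i)) = c (i + j)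

/-- The one-step extension: a bounded Hankel matrix stays bounded, with an arbitrarily small loss in
the norm, when a suitable scalar is put in front of the sequence of its entries. -/
lemma IsHankel.exists_cons {v : HilbertBasis ℕ ℂ E} {w : HilbertBasis ℕ ℂ F} {c : ℕ → ℂ}
    {C C' : ℝ} (h : IsHankel v w c C) (hC : C < C') :
    ∃ x : ℂ, IsHankel v w (fun n => Nat.casesOn n x c) C' := by
  obtain ⟨G, hG, hc⟩ := h
  have hC' : 0 < C' := (norm_nonneg G).trans_lt (hG.trans_lt hC)
  have hGle (x : E) : ‖G x‖ ^ 2 ≤ C' ^ 2 * ‖x‖ ^ 2 := by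
    rw [← mul_pow]
    exact pow_le_pow_left₀ (norm_nonneg _) (G.le_of_opNorm_le (hG.trans hC.le) x) 2
  -- The Hankel property: `G` intertwines the shift on `E` with the backward shift on `F`.
  have hint (x : E) : G (shift v x) = adjoint (shift w) (G x) := by
    have : G ∘L shift v = adjoint (shift w) ∘L G :=
      clm_ext_hilbertBasis v fun i => ext_hilbertBasis w fun j => by
        simp only [ContinuousLinearMap.comp_apply]
        rw [adjoint_inner_right, shift_basis, shift_basis, hc, hc, Nat.add_right_comm, Nat.add_assoc]
    exact congrArg (fun T => T x) this
  have hGM : ‖G ∘L shift v‖ < C' := by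
    refine lt_of_le_of_lt (ContinuousLinearMap.opNorm_le_bound _ (norm_nonneg G) fun x => ?_)
      (hG.trans_lt hC)
    simpa [norm_shift] using G.le_opNorm (shift v x)
  obtain ⟨x, hx⟩ := exists_corner_bound hGM (G (v 0)) (adjoint G (w 0))
    (fun s u => by
      have := hGle (s • v 0 + shift v u)
      rwa [norm_sq_smul_add_shift, map_add, map_smul] at this)
    (fun u => by
      have h1 := norm_sq_smul_add_shift w (inner ℂ (w 0) (G u)) (adjoint (shift w) (G u))
      rw [shift_adjoint_shift] at h1
      rw [adjoint_inner_left, ContinuousLinearMap.comp_apply, hint, ← h1]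
      exact hGle u)
  refine ⟨x, (innerSL ℂ (v 0)).smulRight (x • w 0 + shift w (G (v 0))) +
    G ∘L adjoint (shift v), ContinuousLinearMap.opNorm_le_bound _ hC'.le fun y => ?_, fun i j => ?_⟩
  · set s := inner ℂ (v 0) y with hs
    set u := adjoint (shift v) y with hu
    have hy : ‖y‖ ^ 2 = ‖s‖ ^ 2 + ‖u‖ ^ 2 := by
      rw [← norm_sq_smul_add_shift v, hs, hu, shift_adjoint_shift]
    have e : ((innerSL ℂ (v 0)).smulRight (x • w 0 + shift w (G (v 0))) +
        G ∘L adjoint (shift v)) y =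
        (s * x + inner ℂ (w 0) (G u)) • w 0 + shift w (s • G (v 0) + G (shift v u)) := by
      rw [hint]
      simp only [add_apply, ContinuousLinearMap.smulRight_apply,
        innerSL_apply_apply, ContinuousLinearMap.comp_apply, map_add, map_smul]
      conv_lhs => rw [← hu, ← shift_adjoint_shift w (G u)]
      rw [← hs]
      module
    have h2 := hx s u
    rw [adjoint_inner_left, ContinuousLinearMap.comp_apply] at h2
    rw [e]
    refine le_of_sq_le_sq ?_ (by positivity)
    rw [norm_sq_smul_add_shift, mul_pow, hy]
    exact h2
  · cases i with
    | zero =>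
      cases j with
      | zero =>
        simp [adjoint_shift_basis_zero, v.orthonormal.1 0, w.orthonormal.1 0,
          inner_basis_zero_shift]
      | succ j =>
        have : inner ℂ (w (j + 1)) (w 0) = 0 := w.orthonormal.2 (Nat.succ_ne_zero j)
        simp [adjoint_shift_basis_zero, v.orthonormal.1 0, this, ← adjoint_inner_left,
          adjoint_shift_basis_succ]
        simpa [adjoint_inner_left] using hc 0 j
    | succ i =>
      have : inner ℂ (v 0) (v (i + 1)) = 0 := v.orthonormal.2 (Nat.succ_ne_zero i).symm
      simp [adjoint_shift_basis_succ, this, hc, Nat.add_right_comm]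

/-- Nehari's theorem for matrices: the entries of a bounded Hankel matrix extend to a two-sided
sequence all of whose left truncations are again the entries of Hankel matrices, with a common
bound. -/
theorem IsHankel.exists_extension {v : HilbertBasis ℕ ℂ E} {w : HilbertBasis ℕ ℂ F} {c : ℕ → ℂ}
    {C : ℝ} (h : IsHankel v w c C) :
    ∃ γ : ℤ → ℂ, (∀ n : ℕ, γ n = c n) ∧
      ∀ k : ℕ, IsHankel v w (fun n => γ (n - k)) (C + 1) := by
  -- The bounds `C + 1 - 2⁻ᵏ` leave room for a loss at every step.
  have hstep (k : ℕ) (d : ℕ → ℂ) : ∃ x : ℂ, IsHankel v w d (C + 1 - (1 / 2) ^ k) →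
      IsHankel v w (fun n => Nat.casesOn n x d) (C + 1 - (1 / 2) ^ (k + 1)) := by
    by_cases hd : IsHankel v w d (C + 1 - (1 / 2) ^ k)
    · obtain ⟨x, hx⟩ := hd.exists_cons (C' := C + 1 - (1 / 2) ^ (k + 1)) (by
        have : (0 : ℝ) < (1 / 2) ^ k := by positivity
        rw [pow_succ]; linarith)
      exact ⟨x, fun _ => hx⟩
    · exact ⟨0, fun h => absurd h hd⟩
  choose x hx using hstep
  let f : ℕ → ℕ → ℂ := fun k => Nat.rec c (fun k d n => Nat.casesOn n (x k d) d) k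
  have hf (k : ℕ) : IsHankel v w (f k) (C + 1 - (1 / 2) ^ k) := by
    induction k with
    | zero => simpa [f] using h
    | succ k ih => exact hx k (f k) ih
  have hfs (r k n : ℕ) : f (k + r) (n + r) = f k n := by
    induction r with
    | zero => rfl
    | succ r ih => exact ih
  refine ⟨fun n => f n.natAbs (n + n.natAbs).toNat, fun n => ?_, fun k => ?_⟩
  · have e1 : ((n : ℤ) + (n : ℤ).natAbs).toNat = n + n := by omega
    have h1 := hfs n 0 n
    rw [zero_add] at h1
    simp only [e1]
    exact h1
  · obtain ⟨G, hG, hc⟩ := hf k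
    refine ⟨G, hG.trans (by simp), fun i j => ?_⟩
    rw [hc]
    generalize i + j = n
    dsimp only
    rcases le_total k n with hkn | hkn
    · obtain ⟨m, rfl⟩ := Nat.exists_eq_add_of_le hkn
      have e1 : (((k + m : ℕ) : ℤ) - k).natAbs = m := by omega
      have e2 : (((k + m : ℕ) : ℤ) - k + m).toNat = m + m := by omega
      rw [e1, e2, add_comm k m]
      have h1 := hfs k 0 m
      have h2 := hfs m 0 m
      rw [zero_add] at h1 h2
      rw [h1, h2]
    · obtain ⟨m, rfl⟩ := Nat.exists_eq_add_of_le hkn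
      have e1 : ((n : ℤ) - ((n + m : ℕ) : ℤ)).natAbs = m := by omega
      have e2 : ((n : ℤ) - ((n + m : ℕ) : ℤ) + m).toNat = 0 := by omega
      rw [e1, e2]
      have h1 := hfs n m 0
      rwa [zero_add, add_comm m n] at h1

end HilbertSpace

open Filter Topology

/-! ### Multiplication operators and Fourier coefficients -/

/-- The product of two functions in `L^∞`. -/
def mulInf (φ ψ : Linf) : Linf := (ContinuousLinearMap.mul ℂ ℂ).holder ∞ φ ψ

lemma coeFn_mulInf (φ ψ : Linf) : mulInf φ ψ =ᵐ[circleMeasure] fun x => φ x * ψ x :=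
  (ContinuousLinearMap.mul ℂ ℂ).coeFn_holder φ ψ

lemma mulOp_mulOp (φ ψ : Linf) (f : L2) : mulOp φ (mulOp ψ f) = mulOp (mulInf φ ψ) f := by
  apply Lp.ext
  filter_upwards [coeFn_mulOp φ (mulOp ψ f), coeFn_mulOp ψ f, coeFn_mulOp (mulInf φ ψ) f,
    coeFn_mulInf φ ψ] with x h1 h2 h3 h4
  rw [h1, h2, h3, h4, mul_assoc]

lemma mulOp_comm (φ ψ : Linf) (f : L2) : mulOp φ (mulOp ψ f) = mulOp ψ (mulOp φ f) := by
  apply Lp.ext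
  filter_upwards [coeFn_mulOp φ (mulOp ψ f), coeFn_mulOp ψ f, coeFn_mulOp ψ (mulOp φ f),
    coeFn_mulOp φ f] with x h1 h2 h3 h4
  rw [h1, h2, h3, h4, mul_left_comm]

lemma inner_mulOp_left (φ : Linf) (f g : L2) :
    inner ℂ (mulOp φ f) g = inner ℂ f (mulOp (star φ) g) := by
  rw [L2.inner_def, L2.inner_def]
  refine integral_congr_ae ?_
  filter_upwards [coeFn_mulOp φ f, coeFn_mulOp (star φ) g, Lp.coeFn_star φ] with x h1 h2 h3
  rw [h1, h2, h3]
  simp only [RCLike.inner_apply, map_mul, Pi.star_apply, RCLike.star_def]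
  ring

lemma inner_mulOp_mulOp {u : Linf} (hu : ∀ᵐ x ∂circleMeasure, ‖u x‖ = 1) (f g : L2) :
    inner ℂ (mulOp u f) (mulOp u g) = inner ℂ f g := by
  rw [L2.inner_def, L2.inner_def]
  refine integral_congr_ae ?_
  filter_upwards [coeFn_mulOp u f, coeFn_mulOp u g, hu] with x h1 h2 h3
  have h : u x * (starRingEnd ℂ) (u x) = 1 := by rw [RCLike.mul_conj, h3]; simp
  rw [h1, h2]
  simp only [RCLike.inner_apply, map_mul]
  linear_combination g x * (starRingEnd ℂ) (f x) * h

lemma mulOp_star_mulOp {u : Linf} (hu : ∀ᵐ x ∂circleMeasure, ‖u x‖ = 1) (f : L2) :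
    mulOp (star u) (mulOp u f) = f := by
  refine ext_inner_left ℂ fun g => ?_
  rw [← inner_mulOp_left, inner_mulOp_mulOp hu]

lemma mulOp_mulOp_star {u : Linf} (hu : ∀ᵐ x ∂circleMeasure, ‖u x‖ = 1) (f : L2) :
    mulOp u (mulOp (star u) f) = f := by
  rw [mulOp_comm, mulOp_star_mulOp hu]

lemma norm_fourierLp_apply (n : ℤ) :
    ∀ᵐ x ∂circleMeasure, ‖(fourierLp (T := (1 : ℝ)) ∞ n) x‖ = 1 := by
  filter_upwards [coeFn_fourierLp (T := (1 : ℝ)) ∞ n] with x hx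
  rw [hx, fourier_apply, Circle.norm_coe]

lemma mulOp_fourierLp (m n : ℤ) :
    mulOp (fourierLp ∞ m) (fourierLp (T := (1 : ℝ)) 2 n) = fourierLp 2 (m + n) := by
  apply Lp.ext
  filter_upwards [coeFn_mulOp (fourierLp ∞ m) (fourierLp (T := (1 : ℝ)) 2 n),
    coeFn_fourierLp (T := (1 : ℝ)) ∞ m, coeFn_fourierLp (T := (1 : ℝ)) 2 n,
    coeFn_fourierLp (T := (1 : ℝ)) 2 (m + n)] with x h1 h2 h3 h4
  rw [h1, h2, h3, h4, fourier_add]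

lemma inner_fourierLp (n : ℤ) (f : L2) :
    inner ℂ (fourierLp (T := (1 : ℝ)) 2 n) f = fourierCoeff f n := by
  rw [← fourierBasis_repr, HilbertBasis.repr_apply_apply, coe_fourierBasis]

lemma ext_fourierCoeff {f g : L2} (h : ∀ n, fourierCoeff f n = fourierCoeff g n) : f = g :=
  ext_hilbertBasis fourierBasis fun n => by
    rw [coe_fourierBasis, inner_fourierLp, inner_fourierLp, h]

lemma fourierCoeff_mulOp_fourierLp (m n : ℤ) (f : L2) :
    fourierCoeff (mulOp (fourierLp ∞ m) f) n = fourierCoeff f (n - m) := by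
  rw [← inner_fourierLp, ← inner_fourierLp, ← inner_mulOp_mulOp (norm_fourierLp_apply m) _ f,
    mulOp_fourierLp, add_sub_cancel]

lemma fourierCoeff_mulOp_apply_fourierLp (φ : Linf) (m n : ℤ) :
    fourierCoeff (mulOp φ (fourierLp 2 m)) n = fourierCoeff φ (n - m) := by
  refine integral_congr_ae ?_
  filter_upwards [coeFn_mulOp φ (fourierLp 2 m), coeFn_fourierLp (T := (1 : ℝ)) 2 m] with x h1 h2
  rw [h1, h2, show -(n - m) = -n + m by ring, fourier_add, smul_eq_mul, smul_eq_mul]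
  ring

/-! ### Bounded Laurent matrices and their symbols -/

/-- The Laurent matrix `(γ (n - m))` is bounded by `C` on finitely supported vectors. -/
def IsLaurentBounded (γ : ℤ → ℂ) (C : ℝ) : Prop :=
  ∀ (s t : Finset ℤ) (a : ℤ → ℂ),
    ∑ n ∈ t, ‖∑ m ∈ s, a m * γ (n - m)‖ ^ 2 ≤ C ^ 2 * ∑ m ∈ s, ‖a m‖ ^ 2

lemma IsLaurentBounded.comp_neg {γ : ℤ → ℂ} {C : ℝ} (h : IsLaurentBounded γ C) :
    IsLaurentBounded (fun n => γ (-n)) C := by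
  intro s t a
  have := h (s.map (Equiv.neg ℤ).toEmbedding) (t.map (Equiv.neg ℤ).toEmbedding) (fun n => a (-n))
  simpa only [Finset.sum_map, Equiv.coe_toEmbedding, Equiv.neg_apply, neg_neg, neg_sub_neg,
    neg_sub] using this

lemma norm_sq_sum_fourierLp (s : Finset ℤ) (a : ℤ → ℂ) :
    ‖∑ m ∈ s, a m • fourierLp (T := (1 : ℝ)) 2 m‖ ^ 2 = ∑ m ∈ s, ‖a m‖ ^ 2 := by
  rw [@norm_sq_eq_re_inner ℂ, orthonormal_fourier.inner_sum, map_sum]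
  refine Finset.sum_congr rfl fun m _ => ?_
  rw [RCLike.conj_mul]
  norm_cast

/-- If multiplication by `φ ∈ L²` is bounded by `C` on trigonometric polynomials, then `|φ| ≤ C + 1`
almost everywhere. -/
theorem exists_linf_of_mul_bound (φ : L2) {C : ℝ} (hC : 0 ≤ C)
    (h : ∀ (s : Finset ℤ) (a : ℤ → ℂ), ‖mulOp (∑ m ∈ s, a m • fourierLp ∞ m) φ‖ ≤
      C * ‖∑ m ∈ s, a m • fourierLp (T := (1 : ℝ)) 2 m‖) :
    ∃ ψ : Linf, ψ =ᵐ[circleMeasure] φ := by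
  -- The bound passes from trigonometric polynomials to all of `L²`, by Fatou's lemma.
  have key (f : L2) : eLpNorm (fun x => f x * φ x) 2 circleMeasure ≤ ENNReal.ofReal (C * ‖f‖) := by
    have hf : f ∈ closure (Submodule.span ℂ (Set.range (fourierLp (T := (1 : ℝ)) 2)) : Set L2) := by
      have := span_fourierLp_closure_eq_top (T := (1 : ℝ)) (p := 2) (by simp)
      rw [← Submodule.topologicalClosure_coe, this]
      trivial
    obtain ⟨p, hp, hpf⟩ := mem_closure_iff_seq_limit.1 hf
    have hb (n : ℕ) :
        eLpNorm (fun x => p n x * φ x) 2 circleMeasure ≤ ENNReal.ofReal (C * ‖p n‖) := by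
      obtain ⟨c, hc⟩ := Finsupp.mem_span_range_iff_exists_finsupp.1 (hp n)
      let g : C(AddCircle (1 : ℝ), ℂ) := ∑ m ∈ c.support, c m • fourier m
      have e2 : ∑ m ∈ c.support, c m • fourierLp (T := (1 : ℝ)) 2 m =
          ContinuousMap.toLp 2 circleMeasure ℂ g := by
        simp only [g, map_sum, map_smul, fourierLp]
      have einf : ∑ m ∈ c.support, c m • fourierLp (T := (1 : ℝ)) ∞ m =
          ContinuousMap.toLp ∞ circleMeasure ℂ g := by
        simp only [g, map_sum, map_smul, fourierLp]
      have hpn : p n = ContinuousMap.toLp 2 circleMeasure ℂ g := by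
        rw [← hc, ← e2]; rfl
      have hn := h c.support c
      rw [e2, einf, ← hpn] at hn
      have hae : (fun x => p n x * φ x) =ᵐ[circleMeasure]
          mulOp (ContinuousMap.toLp ∞ circleMeasure ℂ g) φ := by
        rw [hpn]
        filter_upwards [coeFn_mulOp (ContinuousMap.toLp ∞ circleMeasure ℂ g) φ,
          ContinuousMap.coeFn_toLp (p := 2) (𝕜 := ℂ) circleMeasure g,
          ContinuousMap.coeFn_toLp (p := ∞) (𝕜 := ℂ) circleMeasure g] with x h1 h2 h3
        rw [h1, h2, h3]
      rw [eLpNorm_congr_ae hae, ← Lp.enorm_def, ← ofReal_norm]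
      exact ENNReal.ofReal_le_ofReal hn
    obtain ⟨ns, hns, hlim⟩ := (tendstoInMeasure_of_tendsto_Lp hpf).exists_seq_tendsto_ae
    have hF := Lp.eLpNorm_lim_le_liminf_eLpNorm (p := 2) (μ := circleMeasure)
      (f := fun n x => p (ns n) x * φ x)
      (fun n => (Lp.aestronglyMeasurable _).mul (Lp.aestronglyMeasurable _))
      (fun x => f x * φ x) (by filter_upwards [hlim] with x hx using hx.mul_const _)
    refine hF.trans ((liminf_le_liminf (Eventually.of_forall fun n => hb (ns n))).trans_eq ?_)
    refine Tendsto.liminf_eq (ENNReal.tendsto_ofReal ?_)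
    exact ((hpf.comp hns.tendsto_atTop).norm).const_mul C
  -- Test the bound against the indicator function of the set where `|φ| > C + 1`.
  set S : Set (AddCircle (1 : ℝ)) := {x | C + 1 < ‖φ x‖}
  have hSm : MeasurableSet S :=
    measurableSet_lt measurable_const (Lp.stronglyMeasurable φ).norm.measurable
  set f : L2 := indicatorConstLp 2 hSm (measure_ne_top circleMeasure S) 1 with hf
  have h1 : eLpNorm (fun x => ((C + 1 : ℝ) : ℂ) • f x) 2 circleMeasure ≤
      eLpNorm (fun x => f x * φ x) 2 circleMeasure := by
    refine eLpNorm_mono_ae ?_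
    filter_upwards [indicatorConstLp_coeFn (p := 2) (hs := hSm)
      (hμs := measure_ne_top circleMeasure S) (c := (1 : ℂ))] with x hx
    rw [hf, hx]
    by_cases hxS : x ∈ S
    · simp only [Set.indicator_of_mem hxS, one_mul, norm_smul, norm_one, mul_one,
        Complex.norm_real, Real.norm_of_nonneg (by linarith : (0 : ℝ) ≤ C + 1)]
      exact hxS.le
    · simp [Set.indicator_of_notMem hxS]
  have h2 : eLpNorm (fun x => ((C + 1 : ℝ) : ℂ) • f x) 2 circleMeasure =
      ENNReal.ofReal ((C + 1) * ‖f‖) := by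
    have := eLpNorm_const_smul ((C + 1 : ℝ) : ℂ) f 2 circleMeasure
    rw [← Lp.enorm_def, ← ofReal_norm, ← ofReal_norm, ← ENNReal.ofReal_mul (norm_nonneg _),
      Complex.norm_real, Real.norm_of_nonneg (by linarith : (0 : ℝ) ≤ C + 1)] at this
    exact this
  have h3 : (C + 1) * ‖f‖ ≤ C * ‖f‖ := by
    have := h2.symm.trans_le (h1.trans (key f))
    rwa [ENNReal.ofReal_le_ofReal_iff (by positivity)] at this
  have h4 : circleMeasure S = 0 := by
    by_contra hne
    have h5 : ‖f‖ = 0 := le_antisymm (by linarith) (norm_nonneg _)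
    rw [hf, norm_indicatorConstLp (by simp) (by simp)] at h5
    have h6 : 0 < circleMeasure.real S :=
      ENNReal.toReal_pos hne (measure_ne_top _ _)
    have : 0 < circleMeasure.real S ^ (1 / (2 : ℝ≥0∞).toReal) := Real.rpow_pos_of_pos h6 _
    rw [norm_one, one_mul] at h5
    exact this.ne' h5
  have h7 : MemLp φ ∞ circleMeasure := by
    refine memLp_top_of_bound (Lp.aestronglyMeasurable _) (C + 1) ?_
    rw [ae_iff]
    simpa only [not_le] using h4
  exact ⟨h7.toLp, h7.coeFn_toLp⟩

/-- A bounded Laurent matrix consists of the Fourier coefficients of a function in `L^∞`. -/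
theorem IsLaurentBounded.exists_symbol {γ : ℤ → ℂ} {C : ℝ} (hC : 0 ≤ C)
    (h : IsLaurentBounded γ C) : ∃ ψ : Linf, ∀ n, fourierCoeff ψ n = γ n := by
  have hγ : Memℓp γ 2 := by
    refine memℓp_gen' (C := C ^ 2) fun t => ?_
    simpa using h {0} t (fun _ => 1)
  let φ : L2 := fourierBasis.repr.symm ⟨γ, hγ⟩
  have hφ (n : ℤ) : fourierCoeff φ n = γ n := by
    rw [← fourierBasis_repr, LinearIsometryEquiv.apply_symm_apply]
  obtain ⟨ψ, hψ⟩ := exists_linf_of_mul_bound φ hC fun s a => by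
    have hsum : mulOp (∑ m ∈ s, a m • fourierLp ∞ m) φ =
        ∑ m ∈ s, a m • mulOp (fourierLp ∞ m) φ := by
      simp only [mulOp, map_sum, map_smul, sum_apply, smul_apply]
    rw [← LinearIsometryEquiv.norm_map fourierBasis.repr]
    refine lp.norm_le_of_forall_sum_le (by simp) (by positivity) fun t => ?_
    have := h s t a
    rw [← norm_sq_sum_fourierLp s, ← mul_pow] at this
    simp only [ENNReal.toReal_ofNat, Real.rpow_ofNat]
    refine le_trans (le_of_eq (Finset.sum_congr rfl fun n _ => ?_)) this
    rw [fourierBasis_repr, hsum, ← inner_fourierLp, inner_sum]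
    congr 2
    refine Finset.sum_congr rfl fun m _ => ?_
    rw [inner_smul_right, inner_fourierLp, fourierCoeff_mulOp_fourierLp, hφ]
  exact ⟨ψ, fun n => by rw [fourierCoeff_congr_ae hψ, hφ]⟩

/-! ### Symbols of Toeplitz and Hankel matrices -/

section HilbertSpace

variable {E F : Type*} [NormedAddCommGroup E] [InnerProductSpace ℂ E]
  [NormedAddCommGroup F] [InnerProductSpace ℂ F]

/-- Bessel's inequality for the matrix entries of a bounded operator. -/
lemma sum_norm_sq_matrix_le (G : E →L[ℂ] F) {v : ℕ → E} {w : ℕ → F} (hv : Orthonormal ℂ v)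
    (hw : Orthonormal ℂ w) {ι κ : Type*} (s : Finset ι) (t : Finset κ) (p : ι → ℕ) (q : κ → ℕ)
    (hp : Set.InjOn p s) (hq : Set.InjOn q t) (a : ι → ℂ) {C : ℝ} (hC : ‖G‖ ≤ C) :
    ∑ n ∈ t, ‖∑ m ∈ s, a m * inner ℂ (w (q n)) (G (v (p m)))‖ ^ 2 ≤
      C ^ 2 * ∑ m ∈ s, ‖a m‖ ^ 2 := by
  classical
  set x : E := ∑ m ∈ s, a m • v (p m) with hx
  have hxn : ‖x‖ ^ 2 = ∑ m ∈ s, ‖a m‖ ^ 2 := by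
    have ho := hv.comp (fun m : s => p m) (fun m n h => Subtype.ext (hp m.2 n.2 h))
    have := ho.inner_sum (fun m => a m) (fun m => a m) Finset.univ
    rw [hx, @norm_sq_eq_re_inner ℂ, ← Finset.sum_coe_sort s, ← Finset.sum_coe_sort s]
    refine (congrArg RCLike.re this).trans ?_
    rw [map_sum]
    refine Finset.sum_congr rfl fun m _ => ?_
    rw [RCLike.conj_mul]
    norm_cast
  have h1 : ∑ n ∈ t, ‖inner ℂ (w (q n)) (G x)‖ ^ 2 ≤ ‖G x‖ ^ 2 := by
    rw [← Finset.sum_image (s := t) (g := q) (f := fun j => ‖inner ℂ (w j) (G x)‖ ^ 2) hq]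
    exact hw.sum_inner_products_le _
  have h2 : ‖G x‖ ^ 2 ≤ C ^ 2 * ‖x‖ ^ 2 := by
    rw [← mul_pow]
    exact pow_le_pow_left₀ (norm_nonneg _) (G.le_of_opNorm_le hC x) 2
  rw [← hxn]
  refine le_trans (le_of_eq (Finset.sum_congr rfl fun n _ => ?_)) (h1.trans h2)
  rw [hx, map_sum, inner_sum]
  simp only [map_smul, inner_smul_right]

lemma exists_nat_forall_natAbs_le (s : Finset ℤ) : ∃ N : ℕ, ∀ n ∈ s, n.natAbs ≤ N :=
  ⟨s.sup Int.natAbs, fun _ hn => Finset.le_sup (f := Int.natAbs) hn⟩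

/-- Brown and Halmos: the entries of a bounded Toeplitz matrix form a bounded Laurent matrix. -/
lemma isLaurentBounded_of_toeplitz (G : E →L[ℂ] F) {v : ℕ → E} {w : ℕ → F} (hv : Orthonormal ℂ v)
    (hw : Orthonormal ℂ w) {γ : ℤ → ℂ} (h : ∀ i j : ℕ, inner ℂ (w j) (G (v i)) = γ (j - i)) :
    IsLaurentBounded γ ‖G‖ := by
  classical
  intro s t a
  obtain ⟨N, hN⟩ := exists_nat_forall_natAbs_le (s ∪ t)
  have hs : ∀ m ∈ s, m.natAbs ≤ N := fun m hm => hN m (Finset.mem_union_left _ hm)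
  have ht : ∀ m ∈ t, m.natAbs ≤ N := fun m hm => hN m (Finset.mem_union_right _ hm)
  have := sum_norm_sq_matrix_le G hv hw s t (fun m => (m + N).toNat) (fun n => (n + N).toNat)
    (fun m hm n hn hmn => by have := hs m hm; have := hs n hn; dsimp only at hmn; omega)
    (fun m hm n hn hmn => by have := ht m hm; have := ht n hn; dsimp only at hmn; omega) a le_rfl
  refine le_trans (le_of_eq (Finset.sum_congr rfl fun n hn => ?_)) this
  congr 2
  refine Finset.sum_congr rfl fun m hm => ?_
  rw [h]
  congr 2
  have := hs m hm
  have := ht n hn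
  omega

variable [CompleteSpace E] [CompleteSpace F]

/-- Nehari: the entries of a bounded Hankel matrix extend to the entries of a bounded Laurent
matrix. -/
lemma IsHankel.exists_isLaurentBounded {v : HilbertBasis ℕ ℂ E} {w : HilbertBasis ℕ ℂ F}
    {c : ℕ → ℂ} {C : ℝ} (h : IsHankel v w c C) :
    ∃ γ : ℤ → ℂ, (∀ n : ℕ, γ n = c n) ∧ IsLaurentBounded γ (C + 1) := by
  classical
  obtain ⟨γ, hγ, hk⟩ := h.exists_extension
  refine ⟨γ, hγ, fun s t a => ?_⟩
  obtain ⟨N, hN⟩ := exists_nat_forall_natAbs_le (s ∪ t)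
  have hs : ∀ m ∈ s, m.natAbs ≤ N := fun m hm => hN m (Finset.mem_union_left _ hm)
  have ht : ∀ m ∈ t, m.natAbs ≤ N := fun m hm => hN m (Finset.mem_union_right _ hm)
  obtain ⟨G, hG, hc⟩ := hk (2 * N)
  -- Reversing the columns, `m ↦ N - m`, turns a window of the Laurent matrix into a Hankel matrix.
  have := sum_norm_sq_matrix_le G v.orthonormal w.orthonormal s t (fun m => (N - m).toNat)
    (fun n => (n + N).toNat)
    (fun m hm n hn hmn => by have := hs m hm; have := hs n hn; dsimp only at hmn; omega)
    (fun m hm n hn hmn => by have := ht m hm; have := ht n hn; dsimp only at hmn; omega) a hG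
  refine le_trans (le_of_eq (Finset.sum_congr rfl fun n hn => ?_)) this
  congr 2
  refine Finset.sum_congr rfl fun m hm => ?_
  rw [hc]
  congr 2
  have := hs m hm
  have := ht n hn
  push_cast
  omega

end HilbertSpace

/-! ### The Hardy space and its complement -/

lemma fourierCoeff_fourierLp (m n : ℤ) :
    fourierCoeff (fourierLp (T := (1 : ℝ)) 2 m) n = if n = m then 1 else 0 := by
  rw [← inner_fourierLp, orthonormal_iff_ite.1 orthonormal_fourier]

lemma fourierLp_mem_hardySpace (n : ℕ) : fourierLp (T := (1 : ℝ)) 2 (n : ℤ) ∈ hardySpace := by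
  intro m hm
  rw [fourierCoeff_fourierLp, if_neg (by omega)]

lemma mem_hardyMinus_iff {f : L2} : f ∈ hardyMinus ↔ ∀ n : ℕ, fourierCoeff f n = 0 := by
  refine ⟨fun h n => ?_, fun h => (Submodule.mem_orthogonal _ _).2 fun g hg => ?_⟩
  · rw [← inner_fourierLp]
    exact Submodule.inner_right_of_mem_orthogonal (fourierLp_mem_hardySpace n) h
  · rw [← fourierBasis.tsum_inner_mul_inner g f]
    refine (tsum_congr fun n => ?_).trans tsum_zero
    rw [coe_fourierBasis, ← inner_conj_symm, inner_fourierLp, inner_fourierLp]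
    rcases lt_or_ge n 0 with hn | hn
    · rw [hg n hn, map_zero, zero_mul]
    · lift n to ℕ using hn
      rw [h n, mul_zero]

lemma InnerFunction.timesHardy_le_hardySpace (θ : InnerFunction) : θ.timesHardy ≤ hardySpace := by
  rintro _ ⟨f, hf, rfl⟩ n hn
  have h : mulOp (star θ.toLinf) (fourierLp 2 n) ∈ hardyMinus := mem_hardyMinus_iff.2 fun m => by
    rw [← inner_fourierLp, ← inner_mulOp_left, ← inner_conj_symm, inner_fourierLp,
      fourierCoeff_mulOp_apply_fourierLp, θ.fourierCoeff_eq_zero _ (by omega), map_zero]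
  rw [ContinuousLinearMap.coe_coe, ← inner_fourierLp, ← star_star θ.toLinf, ← inner_mulOp_left]
  exact Submodule.inner_left_of_mem_orthogonal hf h

lemma isOrtho_timesHardy_hardyMinus (θ : InnerFunction) {f g : L2} (hf : f ∈ θ.timesHardy)
    (hg : g ∈ hardyMinus) : inner ℂ f g = 0 :=
  Submodule.inner_right_of_mem_orthogonal (θ.timesHardy_le_hardySpace hf) hg

instance : CompleteSpace hardySpace := IsClosed.completeSpace_coe (hs := isClosed_hardySpace)

lemma mem_timesHardy_of_mem_modelPerp {θ : InnerFunction} {f : L2} (hf : f ∈ modelPerp θ)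
    (hf' : f ∈ hardySpace) : f ∈ θ.timesHardy := by
  set p : L2 := θ.timesHardy.starProjection f
  have hpm : p ∈ θ.timesHardy := Submodule.starProjection_apply_mem _ f
  have h1 : f - p ∈ modelSpace θ :=
    ⟨hardySpace.sub_mem hf' (θ.timesHardy_le_hardySpace hpm),
      Submodule.sub_starProjection_mem_orthogonal f⟩
  have h2 : f - p ∈ modelPerp θ :=
    (modelPerp θ).sub_mem hf (timesHardy_le_modelPerp θ hpm)
  have h3 : f - p = 0 := inner_self_eq_zero.1 (Submodule.inner_right_of_mem_orthogonal h1 h2)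
  rwa [sub_eq_zero.1 h3]

lemma exists_add_of_mem_modelPerp {θ : InnerFunction} {f : L2} (hf : f ∈ modelPerp θ) :
    ∃ f₁ ∈ θ.timesHardy, ∃ f₂ ∈ hardyMinus, f = f₁ + f₂ := by
  have h2 : f - hardySpace.starProjection f ∈ hardyMinus :=
    Submodule.sub_starProjection_mem_orthogonal f
  refine ⟨hardySpace.starProjection f, mem_timesHardy_of_mem_modelPerp ?_
    (Submodule.starProjection_apply_mem _ f), _, h2, by abel⟩
  have := (modelPerp θ).sub_mem hf (hardyMinus_le_modelPerp θ h2)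
  rwa [sub_sub_cancel] at this

/-- The complement `K_θ^⊥` contains no constant function but `0`: from `c = θ h` with `h ∈ H²` it
follows that the conjugate of `θ` lies in `H²`, as `θ` does. -/
lemma InnerFunction.Nonconstant.eq_zero_of_smul_mem {θ : InnerFunction} (hθ : θ.Nonconstant) {c : ℂ}
    (hc : c • fourierLp (T := (1 : ℝ)) 2 0 ∈ modelPerp θ) : c = 0 := by
  by_contra hc0
  obtain ⟨h, hh, hθh⟩ := mem_timesHardy_of_mem_modelPerp hc
    (hardySpace.smul_mem c (fourierLp_mem_hardySpace 0))
  rw [ContinuousLinearMap.coe_coe] at hθh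
  have hpos (n : ℤ) (hn : 0 < n) : fourierCoeff θ.toLinf n = 0 := by
    have h1 := hh (-n) (by omega)
    rw [← mulOp_star_mulOp θ.norm_eq_one h, hθh, map_smul, ← inner_fourierLp, inner_smul_right,
      ← inner_mulOp_left, ← inner_conj_symm, inner_fourierLp,
      fourierCoeff_mulOp_apply_fourierLp] at h1
    simpa [hc0] using h1
  have h2 : mulOp θ.toLinf (fourierLp 2 0) =
      fourierCoeff θ.toLinf 0 • fourierLp (T := (1 : ℝ)) 2 0 := by
    refine ext_fourierCoeff fun n => ?_
    rw [fourierCoeff_mulOp_apply_fourierLp, ← inner_fourierLp n (_ • _), inner_smul_right,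
      inner_fourierLp, fourierCoeff_fourierLp, sub_zero]
    rcases lt_trichotomy n 0 with hn | rfl | hn
    · rw [θ.fourierCoeff_eq_zero n hn, if_neg hn.ne, mul_zero]
    · simp
    · rw [hpos n hn, if_neg hn.ne', mul_zero]
  refine hθ ⟨fourierCoeff θ.toLinf 0, ?_⟩
  have h3 := coeFn_mulOp θ.toLinf (fourierLp 2 0)
  rw [h2] at h3
  filter_upwards [h3, Lp.coeFn_smul (fourierCoeff θ.toLinf 0) (fourierLp (T := (1 : ℝ)) 2 0),
    coeFn_fourierLp (T := (1 : ℝ)) 2 0] with x e1 e2 e3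
  rw [e2, Pi.smul_apply, e3, fourier_zero] at e1
  simpa using e1.symm

lemma mulOp_zInf_mem_timesHardy {θ : InnerFunction} {f : L2} (hf : f ∈ θ.timesHardy) :
    mulOp zInf f ∈ θ.timesHardy := by
  obtain ⟨h, hh, rfl⟩ := hf
  refine ⟨mulOp zInf h, fun n hn => ?_, mulOp_comm _ _ _⟩
  rw [zInf, fourierCoeff_mulOp_fourierLp]
  exact hh _ (by omega)

/-- If `z f` stays in `K_θ^⊥`, then the components of `f` in `θ H²` and `H²₋` stay in these spaces
under multiplication by `z`. -/
lemma InnerFunction.Nonconstant.exists_add {θ : InnerFunction} (hθ : θ.Nonconstant) {f : L2}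
    (hf : f ∈ modelPerp θ) (hzf : mulOp zInf f ∈ modelPerp θ) :
    ∃ f₁ ∈ θ.timesHardy, ∃ f₂ ∈ hardyMinus, mulOp zInf f₁ ∈ θ.timesHardy ∧
      mulOp zInf f₂ ∈ hardyMinus ∧ f = f₁ + f₂ := by
  obtain ⟨f₁, h₁, f₂, h₂, rfl⟩ := exists_add_of_mem_modelPerp hf
  have hz₁ := mulOp_zInf_mem_timesHardy h₁
  refine ⟨f₁, h₁, f₂, h₂, hz₁, ?_, rfl⟩
  -- The only obstruction is the constant term `c` of `z f₂`, and `c` belongs to `K_θ^⊥`.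
  set c : ℂ := fourierCoeff (mulOp zInf f₂) 0 with hc
  have h3 : mulOp zInf f₂ - c • fourierLp 2 0 ∈ hardyMinus := mem_hardyMinus_iff.2 fun n => by
    rw [← inner_fourierLp, inner_sub_right, inner_smul_right, inner_fourierLp, inner_fourierLp,
      fourierCoeff_fourierLp]
    cases n with
    | zero => simp [hc]
    | succ n =>
      have := mem_hardyMinus_iff.1 h₂ n
      rw [zInf, fourierCoeff_mulOp_fourierLp, Nat.cast_succ, add_sub_cancel_right, this,
        if_neg (by omega), mul_zero, sub_zero]
  have h4 : mulOp zInf f₂ ∈ modelPerp θ := by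
    have := (modelPerp θ).sub_mem hzf (timesHardy_le_modelPerp θ hz₁)
    rwa [map_add, add_sub_cancel_left] at this
  have h5 : c • fourierLp (T := (1 : ℝ)) 2 0 ∈ modelPerp θ := by
    have := (modelPerp θ).sub_mem h4 (hardyMinus_le_modelPerp θ h3)
    rwa [sub_sub_cancel] at this
  rwa [hθ.eq_zero_of_smul_mem h5, zero_smul, sub_zero] at h3

/-! ### Compressions and blocks -/

lemma inner_compression {M N : Submodule ℂ L2} [N.HasOrthogonalProjection] (φ : Linf) (f : M)
    (g : N) : inner ℂ g (compression M N φ f) = inner ℂ (g : L2) (mulOp φ f) :=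
  Submodule.inner_orthogonalProjectionOnto_eq_of_mem_left g _

lemma inner_block {K₁ K₂ M N : Submodule ℂ L2} [N.HasOrthogonalProjection] (hM : M ≤ K₁)
    (D : K₁ →L[ℂ] K₂) (f : M) (g : N) :
    inner ℂ g (block hM N D f) = inner ℂ (g : L2) (D ⟨f, hM f.2⟩ : L2) :=
  Submodule.inner_orthogonalProjectionOnto_eq_of_mem_left g _

lemma isShiftInvariant_compression {M N : Submodule ℂ L2} [N.HasOrthogonalProjection] (φ : Linf) :
    IsShiftInvariant (compression M N φ) := by
  intro f g hf hg
  rw [inner_compression, inner_compression]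
  exact (congrArg _ (mulOp_comm φ zInf f)).trans (inner_mulOp_mulOp (norm_fourierLp_apply 1) _ _)

lemma IsShiftInvariant.block {K₁ K₂ M N : Submodule ℂ L2} [N.HasOrthogonalProjection] (hM : M ≤ K₁)
    (hN : N ≤ K₂) {D : K₁ →L[ℂ] K₂} (hD : IsShiftInvariant D) :
    IsShiftInvariant (block hM N D) := by
  intro f g hf hg
  rw [inner_block, inner_block]
  exact hD ⟨f, hM f.2⟩ ⟨g, hN g.2⟩ (hM hf) (hN hg)

/-- Conversely to `IsShiftInvariant.block`, shift invariance can be checked on the blocks, as the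
components of `f` and `z f` correspond to each other when `θ` and `α` are not constant. -/
lemma isShiftInvariant_of_blocks {θ α : InnerFunction} (hθ : θ.Nonconstant) (hα : α.Nonconstant)
    {D : modelPerp θ →L[ℂ] modelPerp α}
    (h₁ : IsShiftInvariant (block (timesHardy_le_modelPerp θ) α.timesHardy D))
    (h₂ : IsShiftInvariant (block (hardyMinus_le_modelPerp θ) α.timesHardy D))
    (h₃ : IsShiftInvariant (block (timesHardy_le_modelPerp θ) hardyMinus D))
    (h₄ : IsShiftInvariant (block (hardyMinus_le_modelPerp θ) hardyMinus D)) :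
    IsShiftInvariant D := by
  rintro ⟨f, hf⟩ ⟨g, hg⟩ hzf hzg
  obtain ⟨f₁, hf₁, f₂, hf₂, hzf₁, hzf₂, rfl⟩ := hθ.exists_add hf hzf
  obtain ⟨g₁, hg₁, g₂, hg₂, hzg₁, hzg₂, rfl⟩ := hα.exists_add hg hzg
  have e₁ := h₁ ⟨f₁, hf₁⟩ ⟨g₁, hg₁⟩ hzf₁ hzg₁
  have e₂ := h₂ ⟨f₂, hf₂⟩ ⟨g₁, hg₁⟩ hzf₂ hzg₁
  have e₃ := h₃ ⟨f₁, hf₁⟩ ⟨g₂, hg₂⟩ hzf₁ hzg₂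
  have e₄ := h₄ ⟨f₂, hf₂⟩ ⟨g₂, hg₂⟩ hzf₂ hzg₂
  rw [inner_block, inner_block] at e₁ e₂ e₃ e₄
  dsimp only at e₁ e₂ e₃ e₄
  have d : (⟨f₁ + f₂, hf⟩ : modelPerp θ) = ⟨f₁, timesHardy_le_modelPerp θ hf₁⟩ +
      ⟨f₂, hardyMinus_le_modelPerp θ hf₂⟩ := rfl
  have dz : (⟨mulOp zInf (f₁ + f₂), hzf⟩ : modelPerp θ) =
      ⟨mulOp zInf f₁, timesHardy_le_modelPerp θ hzf₁⟩ +
      ⟨mulOp zInf f₂, hardyMinus_le_modelPerp θ hzf₂⟩ := Subtype.ext (map_add _ _ _)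
  rw [Submodule.coe_inner, Submodule.coe_inner]
  dsimp only
  rw [d, dz, map_add, map_add, map_add, Submodule.coe_add, Submodule.coe_add, inner_add_left,
    inner_add_left, inner_add_right, inner_add_right, inner_add_right, inner_add_right, e₁, e₂, e₃,
    e₄]

/-! ### Monomial bases and symbols of blocks -/

/-- A Hilbert basis of `M ⊆ L²` of the form `u, u z^ε, u z^(2ε), …` with `u` unimodular and
`ε = 1` or `ε = -1`. -/
structure MonomialBasis (M : Submodule ℂ L2) where
  /-- the basis -/
  basis : HilbertBasis ℕ ℂ M
  /-- the unimodular factor -/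
  factor : Linf
  /-- the direction in which the exponents run -/
  dir : ℤ
  norm_factor : ∀ᵐ x ∂circleMeasure, ‖factor x‖ = 1
  dir_eq : dir = 1 ∨ dir = -1
  basis_apply : ∀ i : ℕ, (basis i : L2) = mulOp factor (fourierLp 2 (dir * i))

lemma orthonormal_of_coe {M : Submodule ℂ L2} {u : Linf}
    (hu : ∀ᵐ x ∂circleMeasure, ‖u x‖ = 1) {ε : ℤ} (hε : ε = 1 ∨ ε = -1) {v : ℕ → M}
    (hv : ∀ i : ℕ, (v i : L2) = mulOp u (fourierLp 2 (ε * i))) : Orthonormal ℂ v := by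
  rw [orthonormal_iff_ite]
  intro i j
  rw [Submodule.coe_inner, hv, hv, inner_mulOp_mulOp hu,
    orthonormal_iff_ite.1 orthonormal_fourier]
  congr 1
  rcases hε with rfl | rfl <;> simp

/-- A family `u z^(ε i)` in `M` is a basis of `M` as soon as no nonzero element of `M` is orthogonal
to it: orthonormality holds because `u` is unimodular. -/
def MonomialBasis.ofSeparating {M : Submodule ℂ L2} [CompleteSpace M] {u : Linf}
    (hu : ∀ᵐ x ∂circleMeasure, ‖u x‖ = 1) {ε : ℤ} (hε : ε = 1 ∨ ε = -1) {v : ℕ → M}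
    (hv : ∀ i : ℕ, (v i : L2) = mulOp u (fourierLp 2 (ε * i)))
    (hs : ∀ f : M, (∀ i, inner ℂ (v i) f = 0) → f = 0) : MonomialBasis M where
  basis := HilbertBasis.mkOfOrthogonalEqBot (orthonormal_of_coe hu hε hv) <| by
    refine (Submodule.eq_bot_iff _).2 fun f hf => hs f fun i => ?_
    exact Submodule.inner_right_of_mem_orthogonal (Submodule.subset_span (Set.mem_range_self i)) hf
  factor := u
  dir := ε
  norm_factor := hu
  dir_eq := hε
  basis_apply i := by rw [HilbertBasis.coe_mkOfOrthogonalEqBot, hv]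

/-- The basis `θ z^i`, `i ≥ 0`, of `θ H²`. -/
def InnerFunction.monomialBasis (θ : InnerFunction) : MonomialBasis θ.timesHardy :=
  MonomialBasis.ofSeparating (u := θ.toLinf) (ε := 1) θ.norm_eq_one (Or.inl rfl)
    (v := fun i => ⟨mulOp θ.toLinf (fourierLp 2 (i : ℤ)),
      Submodule.mem_map_of_mem (fourierLp_mem_hardySpace i)⟩)
    (fun i => by rw [one_mul]) <| by
      rintro ⟨_, f, hf, rfl⟩ h
      have : f = 0 := inner_self_eq_zero.1 <|
        Submodule.inner_right_of_mem_orthogonal hf (mem_hardyMinus_iff.2 fun n => by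
          rw [← inner_fourierLp, ← inner_mulOp_mulOp θ.norm_eq_one]
          exact h n)
      exact Subtype.ext (by simp [this])

/-- The basis `z^(-1-i)`, `i ≥ 0`, of `H²₋`. -/
def hardyMinusBasis : MonomialBasis hardyMinus :=
  MonomialBasis.ofSeparating (u := fourierLp ∞ (-1)) (ε := -1) (norm_fourierLp_apply (-1))
    (Or.inr rfl)
    (v := fun i => ⟨fourierLp 2 (-1 - i), mem_hardyMinus_iff.2 fun n => by
      rw [fourierCoeff_fourierLp, if_neg (by omega)]⟩)
    (fun i => by rw [mulOp_fourierLp, neg_one_mul, ← sub_eq_add_neg]) <| by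
      rintro ⟨f, hf⟩ h
      have : f ∈ hardySpace := fun n hn => by
        have h1 := h (-1 - n).toNat
        rw [Submodule.coe_inner] at h1
        dsimp only at h1
        rwa [inner_fourierLp, show (-1 - ((-1 - n).toNat : ℤ)) = n by omega] at h1
      exact Subtype.ext (inner_self_eq_zero.1 (Submodule.inner_right_of_mem_orthogonal this hf))

lemma mulOp_zInf_basis {M : Submodule ℂ L2} (b : MonomialBasis M) {i i' : ℕ}
    (h : b.dir * i' = b.dir * i + 1) : mulOp zInf (b.basis i) = (b.basis i' : L2) := by
  rw [b.basis_apply, b.basis_apply, mulOp_comm, zInf, mulOp_fourierLp, h, add_comm]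

/-- The matrix of a shift-invariant operator with respect to monomial bases is a Toeplitz or a
Hankel matrix: its entries depend only on the difference of the exponents. -/
lemma IsShiftInvariant.exists_matrix {M N : Submodule ℂ L2} (b : MonomialBasis M)
    (b' : MonomialBasis N) {A : M →L[ℂ] N} (hA : IsShiftInvariant A) :
    ∃ γ : ℤ → ℂ, ∀ i j : ℕ,
      inner ℂ (b'.basis j) (A (b.basis i)) = γ (b'.dir * j - b.dir * i) := by
  set a : ℕ → ℕ → ℂ := fun i j => inner ℂ (b'.basis j) (A (b.basis i))
  have hstep {i i' j j' : ℕ} (hi : b.dir * i' = b.dir * i + 1)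
      (hj : b'.dir * j' = b'.dir * j + 1) : a i' j' = a i j := by
    have h1 := mulOp_zInf_basis b hi
    have h2 := mulOp_zInf_basis b' hj
    have h3 := hA (b.basis i) (b'.basis j) (h1 ▸ (b.basis i').2) (h2 ▸ (b'.basis j').2)
    have h4 : (⟨mulOp zInf (b.basis i), h1 ▸ (b.basis i').2⟩ : M) = b.basis i' := Subtype.ext h1
    have h5 : (⟨mulOp zInf (b'.basis j), h2 ▸ (b'.basis j').2⟩ : N) = b'.basis j' := Subtype.ext h2
    rwa [h4, h5] at h3
  change ∃ γ : ℤ → ℂ, ∀ i j : ℕ, a i j = γ (b'.dir * j - b.dir * i)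
  clear_value a
  have toeplitz (h : ∀ i j, a (i + 1) (j + 1) = a i j) (i j k : ℕ) : a (i + k) (j + k) = a i j := by
    induction k with
    | zero => rfl
    | succ k ih => rw [← ih]; exact h _ _
  have hankel (h : ∀ i j, a (i + 1) j = a i (j + 1)) (i j : ℕ) : a i j = a 0 (i + j) := by
    induction i generalizing j with
    | zero => rw [zero_add]
    | succ i ih => rw [h, ih]; congr 1; omega
  rcases b.dir_eq with hε | hε <;> rcases b'.dir_eq with hε' | hε' <;>
    simp only [hε, hε'] at hstep ⊢
  · have h := toeplitz fun i j => hstep (by push_cast; ring) (by push_cast; ring)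
    refine ⟨fun n => a (-n).toNat n.toNat, fun i j => ?_⟩
    rcases le_total i j with hij | hij <;> obtain ⟨k, rfl⟩ := Nat.exists_eq_add_of_le hij
    · convert h 0 k i using 2 <;> omega
    · convert h k 0 j using 2 <;> omega
  · have h := hankel fun i j => hstep (by push_cast; ring) (by push_cast; ring)
    refine ⟨fun n => a 0 (-n).toNat, fun i j => ?_⟩
    convert h i j using 2
    omega
  · have h := hankel fun i j => (hstep (by push_cast; ring) (by push_cast; ring)).symm
    refine ⟨fun n => a 0 n.toNat, fun i j => ?_⟩
    convert h i j using 2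
    omega
  · have h := toeplitz fun i j => (hstep (by push_cast; ring) (by push_cast; ring)).symm
    refine ⟨fun n => a n.toNat (-n).toNat, fun i j => ?_⟩
    rcases le_total i j with hij | hij <;> obtain ⟨k, rfl⟩ := Nat.exists_eq_add_of_le hij
    · convert h 0 k i using 2 <;> omega
    · convert h k 0 j using 2 <;> omega

/-- The theorems of Brown–Halmos and of Nehari in one statement: a bounded operator whose
matrix with respect to monomial bases depends only on the difference of the exponents is the
compression of a multiplication operator with a bounded symbol. -/
theorem exists_eq_compression {M N : Submodule ℂ L2} [CompleteSpace M] [CompleteSpace N]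
    (b : MonomialBasis M) (b' : MonomialBasis N) {A : M →L[ℂ] N} {γ : ℤ → ℂ}
    (h : ∀ i j : ℕ, inner ℂ (b'.basis j) (A (b.basis i)) = γ (b'.dir * j - b.dir * i)) :
    ∃ φ : Linf, A = compression M N φ := by
  -- It suffices to find a bounded Laurent matrix containing the matrix of `A`.
  suffices H : ∃ (δ : ℤ → ℂ) (C : ℝ), 0 ≤ C ∧ IsLaurentBounded δ C ∧
      ∀ i j : ℕ, γ (b'.dir * j - b.dir * i) = δ (b'.dir * j - b.dir * i) by
    obtain ⟨δ, C, hC, hδ, hγδ⟩ := H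
    obtain ⟨ψ, hψ⟩ := hδ.exists_symbol hC
    refine ⟨mulInf b'.factor (mulInf ψ (star b.factor)), clm_ext_hilbertBasis b.basis fun i =>
      ext_hilbertBasis b'.basis fun j => ?_⟩
    rw [h, hγδ, ← hψ, inner_compression, b.basis_apply, b'.basis_apply, ← mulOp_mulOp,
      ← mulOp_mulOp, mulOp_star_mulOp b.norm_factor, inner_mulOp_mulOp b'.norm_factor,
      inner_fourierLp, fourierCoeff_mulOp_apply_fourierLp]
  have hv := b.basis.orthonormal
  have hw := b'.basis.orthonormal
  rcases b.dir_eq with hε | hε <;> rcases b'.dir_eq with hε' | hε' <;> rw [hε, hε'] at h ⊢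
  · exact ⟨γ, ‖A‖, norm_nonneg A, isLaurentBounded_of_toeplitz A hv hw fun i j => by
      rw [h]; congr 1; ring, fun _ _ => rfl⟩
  · obtain ⟨δ, hδ, hδ'⟩ := IsHankel.exists_isLaurentBounded (v := b.basis) (w := b'.basis)
      (c := fun n => γ (-n)) ⟨A, le_rfl, fun i j => by rw [h]; congr 1; push_cast; ring⟩
    refine ⟨_, _, by positivity, hδ'.comp_neg, fun i j => ?_⟩
    rw [show -(-1 * (j : ℤ) - 1 * i) = (i + j : ℕ) by push_cast; ring, hδ]
    congr 1; push_cast; ring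
  · obtain ⟨δ, hδ, hδ'⟩ := IsHankel.exists_isLaurentBounded (v := b.basis) (w := b'.basis)
      (c := fun n => γ n) ⟨A, le_rfl, fun i j => by rw [h]; congr 1; push_cast; ring⟩
    refine ⟨_, _, by positivity, hδ', fun i j => ?_⟩
    rw [show (1 * (j : ℤ) - -1 * i) = (i + j : ℕ) by push_cast; ring, hδ]
  · have := isLaurentBounded_of_toeplitz A hv hw (γ := fun n => γ (-n)) fun i j => by
      rw [h]; congr 1; ring
    exact ⟨_, ‖A‖, norm_nonneg A, this.comp_neg, fun _ _ => by rw [neg_neg]⟩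

lemma IsShiftInvariant.exists_eq_compression {M N : Submodule ℂ L2} [CompleteSpace M]
    [CompleteSpace N] (b : MonomialBasis M) (b' : MonomialBasis N) {A : M →L[ℂ] N}
    (hA : IsShiftInvariant A) : ∃ φ : Linf, A = compression M N φ := by
  obtain ⟨γ, hγ⟩ := hA.exists_matrix b b'
  exact DualToeplitz.exists_eq_compression b b' hγ

/-! ### Dual truncated Toeplitz operators -/

/-- The matrix entries of a dual truncated Toeplitz operator with symbol `φ ∈ L²`. -/
lemma inner_basis_of_symbol {θ α : InnerFunction} {D : modelPerp θ →L[ℂ] modelPerp α} {φ : L2}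
    (hφ : ∀ (f : modelPerp θ) (b : Linf), b =ᵐ[circleMeasure] (f : L2) →
      D f = (modelPerp α).orthogonalProjectionOnto (mulOp b φ))
    {M N : Submodule ℂ L2} [N.HasOrthogonalProjection] (b : MonomialBasis M) (b' : MonomialBasis N)
    (hM : M ≤ modelPerp θ) (hN : N ≤ modelPerp α) (i j : ℕ) :
    inner ℂ (b'.basis j) (block hM N D (b.basis i)) =
      fourierCoeff (mulOp (star b'.factor) (mulOp b.factor φ)) (b'.dir * j - b.dir * i) := by
  have hae : mulInf b.factor (fourierLp ∞ (b.dir * i)) =ᵐ[circleMeasure] (b.basis i : L2) := by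
    rw [b.basis_apply]
    filter_upwards [coeFn_mulInf b.factor (fourierLp ∞ (b.dir * i)),
      coeFn_mulOp b.factor (fourierLp 2 (b.dir * i)),
      coeFn_fourierLp (T := (1 : ℝ)) ∞ (b.dir * i),
      coeFn_fourierLp (T := (1 : ℝ)) 2 (b.dir * i)] with x h1 h2 h3 h4
    rw [h1, h2, h3, h4]
  rw [inner_block, hφ ⟨b.basis i, hM (b.basis i).2⟩ _ hae]
  have h1 := Submodule.inner_orthogonalProjectionOnto_eq_of_mem_left
    (⟨b'.basis j, hN (b'.basis j).2⟩ : modelPerp α)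
    (mulOp (mulInf b.factor (fourierLp ∞ (b.dir * i))) φ)
  rw [Submodule.coe_inner] at h1
  rw [h1, ← mulOp_mulOp]
  dsimp only
  rw [b'.basis_apply, inner_mulOp_left, mulOp_comm b.factor, mulOp_comm (star b'.factor),
    inner_fourierLp, fourierCoeff_mulOp_fourierLp]

lemma dualToeplitzClass_subset (θ α : InnerFunction) :
    dualToeplitzClass θ α ⊆ toeplitzBlockClass θ α := by
  rintro D ⟨φ, hφ⟩
  obtain ⟨φ₁, h₁⟩ := exists_eq_compression θ.monomialBasis α.monomialBasis
    (inner_basis_of_symbol hφ _ _ (timesHardy_le_modelPerp θ) (timesHardy_le_modelPerp α))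
  obtain ⟨φ₂, h₂⟩ := exists_eq_compression hardyMinusBasis α.monomialBasis
    (inner_basis_of_symbol hφ _ _ (hardyMinus_le_modelPerp θ) (timesHardy_le_modelPerp α))
  obtain ⟨φ₃, h₃⟩ := exists_eq_compression θ.monomialBasis hardyMinusBasis
    (inner_basis_of_symbol hφ _ _ (timesHardy_le_modelPerp θ) (hardyMinus_le_modelPerp α))
  obtain ⟨φ₄, h₄⟩ := exists_eq_compression hardyMinusBasis hardyMinusBasis
    (inner_basis_of_symbol hφ _ _ (hardyMinus_le_modelPerp θ) (hardyMinus_le_modelPerp α))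
  exact ⟨φ₁, φ₂, φ₃, φ₄, h₁, h₂, h₃, h₄⟩

theorem isShiftInvariant_iff_mem_toeplitzBlockClass {θ α : InnerFunction} (hθ : θ.Nonconstant)
    (hα : α.Nonconstant) (D : modelPerp θ →L[ℂ] modelPerp α) :
    IsShiftInvariant D ↔ D ∈ toeplitzBlockClass θ α := by
  constructor
  · intro hD
    obtain ⟨φ₁, h₁⟩ := (hD.block (timesHardy_le_modelPerp θ)
      (timesHardy_le_modelPerp α)).exists_eq_compression θ.monomialBasis α.monomialBasis
    obtain ⟨φ₂, h₂⟩ := (hD.block (hardyMinus_le_modelPerp θ)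
      (timesHardy_le_modelPerp α)).exists_eq_compression hardyMinusBasis α.monomialBasis
    obtain ⟨φ₃, h₃⟩ := (hD.block (timesHardy_le_modelPerp θ)
      (hardyMinus_le_modelPerp α)).exists_eq_compression θ.monomialBasis hardyMinusBasis
    obtain ⟨φ₄, h₄⟩ := (hD.block (hardyMinus_le_modelPerp θ)
      (hardyMinus_le_modelPerp α)).exists_eq_compression hardyMinusBasis hardyMinusBasis
    exact ⟨φ₁, φ₂, φ₃, φ₄, h₁, h₂, h₃, h₄⟩
  · rintro ⟨φ₁, φ₂, φ₃, φ₄, h₁, h₂, h₃, h₄⟩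
    refine isShiftInvariant_of_blocks hθ hα ?_ ?_ ?_ ?_
    · rw [h₁]; exact isShiftInvariant_compression φ₁
    · rw [h₂]; exact isShiftInvariant_compression φ₂
    · rw [h₃]; exact isShiftInvariant_compression φ₃
    · rw [h₄]; exact isShiftInvariant_compression φ₄

/-- The projection `P⁻`, as an operator from `K_θ^⊥` to `K_α^⊥`. -/
def minusProjection (θ α : InnerFunction) : modelPerp θ →L[ℂ] modelPerp α :=
  (Submodule.subtypeL hardyMinus).codRestrict (modelPerp α)
      (fun x => hardyMinus_le_modelPerp α x.2) ∘L
    hardyMinus.orthogonalProjectionOnto ∘L (modelPerp θ).subtypeL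

lemma coe_minusProjection (θ α : InnerFunction) (f : modelPerp θ) :
    (minusProjection θ α f : L2) = hardyMinus.orthogonalProjectionOnto (f : L2) := rfl

/-- Only the lower right block of `P⁻` does not vanish, and that block is the identity. -/
lemma minusProjection_mem_toeplitzBlockClass (θ α : InnerFunction) :
    minusProjection θ α ∈ toeplitzBlockClass θ α := by
  have h0 (f : L2) : mulOp 0 f = 0 := by simp [mulOp]
  refine ⟨0, 0, 0, fourierLp ∞ 0, ?_, ?_, ?_, ?_⟩ <;>
    refine ContinuousLinearMap.ext fun f => ext_inner_left ℂ fun g => ?_ <;>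
    rw [inner_block, coe_minusProjection]
  · refine Eq.trans ?_ (inner_compression _ _ _).symm
    rw [h0, inner_zero_right]
    exact isOrtho_timesHardy_hardyMinus α g.2 (Subtype.coe_prop _)
  · refine Eq.trans ?_ (inner_compression _ _ _).symm
    rw [h0, inner_zero_right]
    exact isOrtho_timesHardy_hardyMinus α g.2 (Subtype.coe_prop _)
  · refine Eq.trans ?_ (inner_compression _ _ _).symm
    rw [h0, inner_zero_right, ← Submodule.coe_inner,
      Submodule.inner_orthogonalProjectionOnto_eq_of_mem_left, ← inner_conj_symm,
      isOrtho_timesHardy_hardyMinus θ f.2 g.2, map_zero]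
  · refine Eq.trans ?_ (inner_compression _ _ _).symm
    rw [← Submodule.coe_inner, Submodule.inner_orthogonalProjectionOnto_eq_of_mem_left]
    congr 1
    refine ext_fourierCoeff fun n => ?_
    rw [fourierCoeff_mulOp_fourierLp, sub_zero]

/-- The lower right block of `P⁻` forces a symbol to be `1`, and the upper left block forces it to
be `0`. -/
lemma minusProjection_notMem_dualToeplitzClass (θ α : InnerFunction) :
    minusProjection θ α ∉ dualToeplitzClass θ α := by
  rintro ⟨φ, hφ⟩
  have h1 : φ = fourierLp 2 0 := ext_fourierCoeff fun n => by
    have h := inner_basis_of_symbol hφ hardyMinusBasis hardyMinusBasis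
      (hardyMinus_le_modelPerp θ) (hardyMinus_le_modelPerp α) n.toNat (-n).toNat
    rw [mulOp_star_mulOp hardyMinusBasis.norm_factor, inner_block, coe_minusProjection,
      ← Submodule.coe_inner, Submodule.inner_orthogonalProjectionOnto_eq_of_mem_left,
      ← Submodule.coe_inner, orthonormal_iff_ite.1 hardyMinusBasis.basis.orthonormal] at h
    rw [show n = hardyMinusBasis.dir * (-n).toNat - hardyMinusBasis.dir * n.toNat by
      change n = -1 * _ - -1 * _; omega, ← h, fourierCoeff_fourierLp]
    change (if (-n).toNat = n.toNat then (1 : ℂ) else 0) =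
      if -1 * ((-n).toNat : ℤ) - -1 * n.toNat = 0 then 1 else 0
    congr 1
    rw [eq_iff_iff]
    omega
  have h2 : mulOp (star α.toLinf) (mulOp θ.toLinf φ) = 0 := ext_fourierCoeff fun n => by
    have h := inner_basis_of_symbol hφ θ.monomialBasis α.monomialBasis
      (timesHardy_le_modelPerp θ) (timesHardy_le_modelPerp α) (-n).toNat n.toNat
    rw [inner_block, coe_minusProjection,
      isOrtho_timesHardy_hardyMinus α (Subtype.coe_prop _) (Subtype.coe_prop _)] at h
    have h3 : n = α.monomialBasis.dir * n.toNat - θ.monomialBasis.dir * (-n).toNat := by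
      change n = 1 * _ - 1 * _; omega
    rw [← inner_fourierLp n 0, inner_zero_right, h, ← h3]
    rfl
  have h3 : ‖φ‖ = 0 := by
    rw [← θ.norm_mulOp, ← mulOp_mulOp_star α.norm_eq_one (mulOp θ.toLinf φ), h2, map_zero,
      norm_zero]
  rw [h1, orthonormal_fourier.1] at h3
  exact one_ne_zero h3

end DualToeplitz

end

theorem theorem4p4 (θ α : DualToeplitz.InnerFunction)
    (hθ : θ.Nonconstant) (hα : α.Nonconstant) :
    (∀ D : DualToeplitz.modelPerp θ →L[ℂ] DualToeplitz.modelPerp α,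
      DualToeplitz.IsShiftInvariant D ↔ D ∈ DualToeplitz.toeplitzBlockClass θ α) ∧
    DualToeplitz.dualToeplitzClass θ α ⊂ DualToeplitz.toeplitzBlockClass θ α :=
  ⟨DualToeplitz.isShiftInvariant_iff_mem_toeplitzBlockClass hθ hα,
    (Set.ssubset_iff_of_subset (DualToeplitz.dualToeplitzClass_subset θ α)).2
      ⟨DualToeplitz.minusProjection θ α,
        DualToeplitz.minusProjection_mem_toeplitzBlockClass θ α,
        DualToeplitz.minusProjection_notMem_dualToeplitzClass θ α⟩⟩
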